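/- For an integer $s\ge 2$ let $$\mathbb{C}H_{s,s}=\Big\{\big([z_0,\dots,z_s],[w_0,\dots,w_s]\big)\in\mathbb{C}P^s\times\mathbb{C}P^s \;\Big|\; z_0\overline{w}_0+\dots+z_s\overline{w}_s=0\Big\}$$ be the complex Milnor manifold, and let $B:\mathbb{C}H_{s,s}\to\mathbb{C}H_{s,s}$ be the coordinate swap $$B\big([z_0,\dots,z_s],[w_0,\dots,w_s]\big)=\big([w_0,\dots,w_s],[z_0,\dots,z_s]\big).$$ Then $B$ is a fixed-point-free involution, and the induced map $B^*:H^*(\mathbb{C}H_{s,s};\mathbb{Z}/2)\to H^*(\mathbb{C}H_{s,s};\mathbb{Z}/2)$ on mod 2 singular cohomology is non-trivial, that is, it is not the identity map. -/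

import Mathlib

open CategoryTheory

/-- Complex projective space `ℂP^n`: the lines through the origin in `ℂ^(n+1)`. -/
abbrev ComplexProjectiveSpace (n : ℕ) : Type :=
  Projectivization ℂ (Fin (n + 1) → ℂ)

/-- The usual topology of `ℂP^n`: the quotient topology from `ℂ^(n+1) \ {0}`. -/
noncomputable instance ComplexProjectiveSpace.topologicalSpace (n : ℕ) :
    TopologicalSpace (ComplexProjectiveSpace n) :=
  TopologicalSpace.coinduced
    (fun v : {v : Fin (n + 1) → ℂ // v ≠ 0} => Projectivization.mk ℂ v.1 v.2) inferInstance

/-- The complex Milnor manifold `ℂH_{r,s}`, `s ≤ r`, as a subset of `ℂP^r × ℂP^s`: the pairs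
`([z₀, …, z_r], [w₀, …, w_s])` with `z₀ w̄₀ + ⋯ + z_s w̄_s = 0`. The equation does not depend on the
choice of homogeneous coordinates, see `mk_mem_milnorSet`. -/
def milnorSet (r s : ℕ) (h : s ≤ r) :
    Set (ComplexProjectiveSpace r × ComplexProjectiveSpace s) :=
  {p | ∑ i : Fin (s + 1),
    p.1.rep (Fin.castLE (Nat.succ_le_succ h) i) * starRingEnd ℂ (p.2.rep i) = 0}

theorem mk_mem_milnorSet {r s : ℕ} (h : s ≤ r) (z : Fin (r + 1) → ℂ) (w : Fin (s + 1) → ℂ)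
    (hz : z ≠ 0) (hw : w ≠ 0) :
    (Projectivization.mk ℂ z hz, Projectivization.mk ℂ w hw) ∈ milnorSet r s h ↔
      ∑ i : Fin (s + 1),
        z (Fin.castLE (Nat.succ_le_succ h) i) * starRingEnd ℂ (w i) = 0 := by
  obtain ⟨a, ha⟩ := Projectivization.exists_smul_eq_mk_rep ℂ z hz
  obtain ⟨b, hb⟩ := Projectivization.exists_smul_eq_mk_rep ℂ w hw
  have key : ∑ i : Fin (s + 1), (a • z) (Fin.castLE (Nat.succ_le_succ h) i) *
        starRingEnd ℂ ((b • w) i) =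
      ((a : ℂ) * starRingEnd ℂ (b : ℂ)) * ∑ i : Fin (s + 1),
        z (Fin.castLE (Nat.succ_le_succ h) i) * starRingEnd ℂ (w i) := by
    rw [Finset.mul_sum]
    refine Finset.sum_congr rfl fun i _ => ?_
    simp only [Pi.smul_apply, Units.smul_def, smul_eq_mul, map_mul]
    ring
  simp only [milnorSet, Set.mem_ofPred_eq]
  rw [← ha, ← hb, key]
  simp

/-- The complex Milnor manifold `ℂH_{r,s}` as a topological space, with the subspace topology. -/
abbrev ComplexMilnorManifold (r s : ℕ) (h : s ≤ r) : Type :=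
  milnorSet r s h

theorem swap_mem_milnorSet {s : ℕ} {p : ComplexProjectiveSpace s × ComplexProjectiveSpace s}
    (hp : p ∈ milnorSet s s le_rfl) : p.swap ∈ milnorSet s s le_rfl := by
  simp only [milnorSet, Set.mem_ofPred_eq, Fin.castLE_rfl, id_eq, Prod.fst_swap,
    Prod.snd_swap] at hp ⊢
  have h2 := congrArg (starRingEnd ℂ) hp
  simpa [map_sum, mul_comm] using h2

/-- The coordinate swap `B : ℂH_{s,s} → ℂH_{s,s}`,
`([z₀, …, z_s], [w₀, …, w_s]) ↦ ([w₀, …, w_s], [z₀, …, z_s])`. -/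
def milnorSwap (s : ℕ) :
    C(ComplexMilnorManifold s s le_rfl, ComplexMilnorManifold s s le_rfl) where
  toFun p := ⟨p.1.swap, swap_mem_milnorSet p.2⟩
  continuous_toFun := by fun_prop

/-- The singular cochain complex of a topological space with mod 2 coefficients: the complex
`Hom(C_•(X; ℤ/2), ℤ/2)`, where `C_•(X; ℤ/2)` is the singular chain complex of `X`. -/
noncomputable def mod2CochainComplex :
    TopCat.{0}ᵒᵖ ⥤ HomologicalComplex (ModuleCat.{0} (ZMod 2)) (ComplexShape.down ℕ).symm :=
  ((AlgebraicTopology.singularChainComplexFunctor (ModuleCat.{0} (ZMod 2))).obj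
      (ModuleCat.of (ZMod 2) (ZMod 2))).op ⋙
    HomologicalComplex.opFunctor _ _ ⋙
    ((linearYoneda (ZMod 2) (ModuleCat.{0} (ZMod 2))).obj
      (ModuleCat.of (ZMod 2) (ZMod 2))).mapHomologicalComplex _

/-- Mod 2 singular cohomology `X ↦ H^*(X; ℤ/2)`, a contravariant functor from topological spaces to
graded `ℤ/2`-vector spaces. -/
noncomputable def mod2Cohomology : TopCat.{0}ᵒᵖ ⥤ GradedObject ℕ (ModuleCat.{0} (ZMod 2)) :=
  mod2CochainComplex ⋙ HomologicalComplex.gradedHomologyFunctor _ _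

/-- The map `f^* : H^*(X; ℤ/2) → H^*(X; ℤ/2)` induced by a continuous self-map `f` of `X`. -/
noncomputable def mod2CohomologyMap {X : Type} [TopologicalSpace X] (f : C(X, X)) :
    mod2Cohomology.obj (Opposite.op (TopCat.of X)) ⟶
      mod2Cohomology.obj (Opposite.op (TopCat.of X)) :=
  mod2Cohomology.map (TopCat.ofHom f).op

/-!
The swap does not fix the following class of degree `2`. Pull back the mod 2 Euler class `x` of the
tautological line bundle of `ℂP^s` along the first projection of the Milnor manifold. If the swap `B` induced the
identity on cohomology, then the pulled back class would take the same value on every singular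
`2`-cycle and on its image under `B`. For `s ≥ 2` the Milnor manifold contains the sphere
`ℓ × {[e_s]}`, where `ℓ` is the projective line spanned by `e_0` and `e_1`: the class is `1` on this
sphere, but `0` on its image under `B`, whose first component is constant.

The homology of `ℂP^s` is not needed for this, only a cocycle that represents `x`; it is the
reduction mod 2 of `eulerCocycle`. A path in `ℂP^s` has a lift to `ℂ^(s+1) \ {0}` that starts and ends at chosen
representatives of its end points, and one such lift is fixed for each path. A `2`-simplex `σ` has a
lift as well, and along the boundary of `σ` this lift and the fixed lifts of the edges differ by a
loop in `ℂ \ {0}`. The winding number of the loop does not depend on the lift of `σ` and is the value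
of the cocycle at `σ`. It is computed with increments of continuous logarithms
(`edgeIncrement`, `boundaryIncrement`). The cocycle condition `eulerCocycle_alternating_sum` follows
from a lift of a `3`-simplex. All these lifts come from `exists_isHomogeneousLift`.

The sphere is represented by a singular triangle with collapsed boundary (`sphereSimplex`), from
which a constant simplex is subtracted to obtain a cycle. By `exists_log_triangleMap` it has winding
number `1`. The passage from cohomology classes to values of cocycles on cycles is
`add_eq_add_of_mod2CohomologyMap_eq_id`.
-/

open scoped Matrix

/-! ### Lifting maps from a convex compact set to projective space -/

/-- A map `g` to `ℂ^(n+1)` lifts a map `f` to `ℂP^n` if `g x` is nonzero and spans the line `f x`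
for all `x`. -/
def IsHomogeneousLift {n : ℕ} {K : Type*} (f : K → ComplexProjectiveSpace n)
    (g : K → Fin (n + 1) → ℂ) : Prop :=
  ∀ x, ∃ h : g x ≠ 0, Projectivization.mk ℂ (g x) h = f x

open scoped ComplexOrder in
theorem star_dotProduct_self_ne_zero {n : ℕ} {v : Fin n → ℂ} (hv : v ≠ 0) :
    star v ⬝ᵥ v ≠ 0 := by
  rwa [dotProduct_comm, Ne, dotProduct_self_star_eq_zero]

/-- The orthogonal projection of `ℂ^(n+1)` onto a line, as a matrix. -/
noncomputable def lineProjection {n : ℕ} (p : ComplexProjectiveSpace n) :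
    Matrix (Fin (n + 1)) (Fin (n + 1)) ℂ :=
  (star p.rep ⬝ᵥ p.rep)⁻¹ • Matrix.vecMulVec p.rep (star p.rep)

theorem lineProjection_mk {n : ℕ} (v : Fin (n + 1) → ℂ) (hv : v ≠ 0) :
    lineProjection (Projectivization.mk ℂ v hv) =
      (star v ⬝ᵥ v)⁻¹ • Matrix.vecMulVec v (star v) := by
  obtain ⟨a, ha⟩ := Projectivization.exists_smul_eq_mk_rep ℂ v hv
  have h1 : star v ⬝ᵥ v ≠ 0 := star_dotProduct_self_ne_zero hv
  have h2 : (a : ℂ) ≠ 0 := a.ne_zero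
  rw [lineProjection, ← ha]
  ext i j
  simp only [Units.smul_def, Matrix.smul_apply, Matrix.vecMulVec_apply, Pi.smul_apply,
    Pi.star_apply, star_smul, smul_dotProduct, dotProduct_smul, smul_eq_mul, RCLike.star_def]
  have h3 : (starRingEnd ℂ) (a : ℂ) ≠ 0 := by simp
  field_simp

theorem continuous_lineProjection {n : ℕ} : Continuous (lineProjection (n := n)) := by
  refine continuous_coinduced_dom.2 ?_
  have : (lineProjection (n := n)) ∘
      (fun v : {v : Fin (n + 1) → ℂ // v ≠ 0} => Projectivization.mk ℂ v.1 v.2) =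
      fun v => (star v.1 ⬝ᵥ v.1)⁻¹ • Matrix.vecMulVec v.1 (star v.1) := by
    funext v
    exact lineProjection_mk v.1 v.2
  rw [this]
  have h : Continuous fun v : {v : Fin (n + 1) → ℂ // v ≠ 0} => v.1 := continuous_subtype_val
  exact ((h.star.dotProduct h).inv₀ fun v => star_dotProduct_self_ne_zero v.2).smul
    (h.matrix_vecMulVec h.star)

theorem lineProjection_mulVec {n : ℕ} (p : ComplexProjectiveSpace n) (v : Fin (n + 1) → ℂ) :
    lineProjection p *ᵥ v = ((star p.rep ⬝ᵥ p.rep)⁻¹ * (star p.rep ⬝ᵥ v)) • p.rep := by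
  rw [lineProjection, Matrix.smul_mulVec, Matrix.vecMulVec_mulVec, op_smul_eq_smul, smul_smul]

theorem trace_lineProjection_mul_self {n : ℕ} (p : ComplexProjectiveSpace n) :
    (lineProjection p * lineProjection p).trace = 1 := by
  have h1 : star p.rep ⬝ᵥ p.rep ≠ 0 := star_dotProduct_self_ne_zero p.rep_nonzero
  simp only [lineProjection, Matrix.smul_mul, Matrix.mul_smul, Matrix.vecMulVec_mul_vecMulVec,
    Matrix.trace_smul, Matrix.trace_vecMulVec, dotProduct_smul, smul_eq_mul]
  rw [dotProduct_comm p.rep]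
  field_simp

/-- A lift can be transported between maps that are nowhere orthogonal, by projecting it. -/
theorem IsHomogeneousLift.lineProjection_mulVec {n : ℕ} {K : Type*}
    {f f' : K → ComplexProjectiveSpace n} {g : K → Fin (n + 1) → ℂ} (hg : IsHomogeneousLift f g)
    (h : ∀ x, (lineProjection (f' x) * lineProjection (f x)).trace ≠ 0) :
    IsHomogeneousLift f' fun x => lineProjection (f' x) *ᵥ g x := by
  intro x
  obtain ⟨h0, h1⟩ := hg x
  have h2 : lineProjection (f' x) *ᵥ g x ≠ 0 := by
    intro h2
    refine h x ?_
    rw [← h1, lineProjection_mk, Matrix.mul_smul, Matrix.mul_vecMulVec, h2]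
    simp
  refine ⟨h2, ?_⟩
  have h3 := _root_.lineProjection_mulVec (f' x) (g x)
  refine Eq.trans ?_ (Projectivization.mk_rep (f' x))
  exact (Projectivization.mk_eq_mk_iff' ℂ _ _ _ (f' x).rep_nonzero).2 ⟨_, h3.symm⟩

/-- Every map from a convex compact set to `ℂP^n` has a continuous lift. The radial contraction of the
set to a point is cut into steps so short that corresponding lines before and after a step are not
orthogonal, and a nonzero vector is transported along the steps by orthogonal projections. -/
theorem exists_isHomogeneousLift {n : ℕ} {V : Type*} [NormedAddCommGroup V] [NormedSpace ℝ V]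
    {S : Set V} (hconv : Convex ℝ S) (hcomp : IsCompact S) (f : C(S, ComplexProjectiveSpace n)) :
    ∃ g : C(S, Fin (n + 1) → ℂ), IsHomogeneousLift f g := by
  rcases S.eq_empty_or_nonempty with rfl | ⟨x₀, hx₀⟩
  · exact ⟨⟨fun _ => 0, continuous_const⟩, fun x => x.2.elim⟩
  have : CompactSpace S := isCompact_iff_compactSpace.1 hcomp
  -- Nearby points of `S` go to nonorthogonal lines.
  obtain ⟨δ, hδ, hnear⟩ : ∃ δ > 0, ∀ x y : S, dist x y < δ →
      (lineProjection (f x) * lineProjection (f y)).trace ≠ 0 := by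
    have hcont : Continuous fun q : S × S =>
        (lineProjection (f q.1) * lineProjection (f q.2)).trace := by
      have h := continuous_lineProjection.comp f.continuous
      exact ((h.comp continuous_fst).matrix_mul (h.comp continuous_snd)).matrix_trace
    obtain ⟨δ, hδ, h⟩ := Metric.uniformContinuous_iff.1
      (CompactSpace.uniformContinuous_of_continuous hcont) 1 one_pos
    refine ⟨δ, hδ, fun x y hxy h0 => ?_⟩
    have := h (a := (x, y)) (b := (x, x)) (by simpa [Prod.dist_eq, dist_comm, hδ] using hxy)
    rw [h0, trace_lineProjection_mul_self] at this
    simp at this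
  obtain ⟨D, hD⟩ := hcomp.isBounded.subset_closedBall x₀
  obtain ⟨N, hN⟩ := exists_nat_gt (D / δ)
  have hD0 : 0 ≤ D := by simpa using hD hx₀
  have hNpos : (0 : ℝ) < N := lt_of_le_of_lt (by positivity) hN
  -- The radial contraction of `S` to `x₀`.
  let c : ℝ → S → S := fun t x => if ht : t ∈ Set.Icc (0 : ℝ) 1 then
    ⟨AffineMap.lineMap x₀ x.1 t, hconv.lineMap_mem hx₀ x.2 ht⟩ else x
  have hc : ∀ t (ht : t ∈ Set.Icc (0 : ℝ) 1) (x : S), (c t x).1 = AffineMap.lineMap x₀ x.1 t :=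
    fun t ht x => by simp only [c, dif_pos ht]
  have hccont : ∀ t ∈ Set.Icc (0 : ℝ) 1, Continuous (c t) := by
    intro t ht
    refine continuous_induced_rng.2 ?_
    have : Subtype.val ∘ c t = fun x : S => AffineMap.lineMap x₀ x.1 t := funext (hc t ht)
    rw [this]
    simp only [AffineMap.lineMap_apply_module]
    fun_prop
  have hmem : ∀ i : ℕ, i ≤ N → (i / N : ℝ) ∈ Set.Icc (0 : ℝ) 1 := fun i hi =>
    ⟨by positivity, by rw [div_le_one hNpos]; exact_mod_cast hi⟩
  have hstep : ∀ i : ℕ, i + 1 ≤ N → ∀ x : S,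
      dist (c ((i + 1 : ℕ) / N) x) (c (i / N) x) < δ := by
    intro i hi x
    rw [Subtype.dist_eq, hc _ (hmem _ hi), hc _ (hmem _ (by omega)), dist_lineMap_lineMap,
      Real.dist_eq]
    have h1 : (((i + 1 : ℕ) : ℝ) / N - i / N) = 1 / N := by push_cast; ring
    have h2 : dist x₀ x.1 ≤ D := by simpa [dist_comm] using hD x.2
    rw [h1, abs_of_pos (by positivity)]
    calc 1 / N * dist x₀ x.1 ≤ 1 / N * D := by gcongr
      _ < δ := by rw [div_lt_iff₀ hδ] at hN; rw [one_div, inv_mul_lt_iff₀ hNpos]; exact hN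
  have key : ∀ i : ℕ, i ≤ N →
      ∃ g : C(S, Fin (n + 1) → ℂ), IsHomogeneousLift (fun x => f (c (i / N) x)) g := by
    intro i
    induction i with
    | zero =>
      intro _
      refine ⟨⟨fun _ => (f ⟨x₀, hx₀⟩).rep, continuous_const⟩,
        fun x => ⟨(f ⟨x₀, hx₀⟩).rep_nonzero, ?_⟩⟩
      have : c ((0 : ℕ) / N) x = ⟨x₀, hx₀⟩ := Subtype.ext (by rw [hc _ (hmem 0 (by omega))]; simp)
      exact (Projectivization.mk_rep _).trans (congrArg f this.symm)
    | succ i ih =>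
      intro hi
      obtain ⟨g, hg⟩ := ih (by omega)
      refine ⟨⟨fun x => lineProjection (f (c ((i + 1 : ℕ) / N) x)) *ᵥ g x, ?_⟩,
        hg.lineProjection_mulVec fun x => hnear _ _ (hstep i hi x)⟩
      have h1 := hccont _ (hmem _ hi)
      exact (continuous_lineProjection.comp (f.continuous.comp h1)).matrix_mulVec g.continuous
  obtain ⟨g, hg⟩ := key N le_rfl
  refine ⟨g, fun x => ?_⟩
  have : c ((N : ℕ) / N) x = x := Subtype.ext (by
    rw [hc _ (hmem N le_rfl), div_self hNpos.ne']; simp)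
  obtain ⟨h1, h2⟩ := hg x
  exact ⟨h1, h2.trans (congrArg f this)⟩

/-- Two continuous lifts of the same map differ by a continuous nonvanishing function. -/
theorem IsHomogeneousLift.exists_smul {n : ℕ} {K : Type*} [TopologicalSpace K]
    {f : K → ComplexProjectiveSpace n} {g g' : C(K, Fin (n + 1) → ℂ)}
    (hg : IsHomogeneousLift f g) (hg' : IsHomogeneousLift f g') :
    ∃ u : C(K, ℂ), (∀ x, u x ≠ 0) ∧ ∀ x, g' x = u x • g x := by
  have hne : ∀ x, star (g x) ⬝ᵥ g x ≠ 0 := fun x =>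
    star_dotProduct_self_ne_zero (hg x).1
  have hu : ∀ x, g' x = ((star (g x) ⬝ᵥ g x)⁻¹ * (star (g x) ⬝ᵥ g' x)) • g x := by
    intro x
    obtain ⟨a, ha⟩ := (Projectivization.mk_eq_mk_iff' ℂ _ _ (hg' x).1 (hg x).1).1
      ((hg' x).2.trans (hg x).2.symm)
    rw [← ha, dotProduct_smul, smul_eq_mul, mul_comm a, inv_mul_cancel_left₀ (hne x)]
  refine ⟨⟨fun x => (star (g x) ⬝ᵥ g x)⁻¹ * (star (g x) ⬝ᵥ g' x), ?_⟩, fun x h0 => ?_, hu⟩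
  · exact Continuous.mul (Continuous.inv₀ (Continuous.dotProduct (by fun_prop) (by fun_prop)) hne)
      (Continuous.dotProduct (by fun_prop) (by fun_prop))
  · refine (hg' x).1 ?_
    rw [hu x]
    simp only [ContinuousMap.coe_mk] at h0
    rw [h0, zero_smul]

/-- A nonvanishing function on a convex set has a continuous logarithm. -/
theorem exists_continuous_log {V : Type*} [NormedAddCommGroup V] [NormedSpace ℝ V]
    {S : Set V} (hconv : Convex ℝ S) (u : C(S, ℂ)) (hu : ∀ x, u x ≠ 0) :
    ∃ l : C(S, ℂ), ∀ x, Complex.exp (l x) = u x := by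
  rcases S.eq_empty_or_nonempty with rfl | ⟨x₀, hx₀⟩
  · exact ⟨⟨fun _ => 0, continuous_const⟩, fun x => x.2.elim⟩
  have := hconv.contractibleSpace ⟨x₀, hx₀⟩
  have := hconv.locallyPathConnectedSpace
  obtain ⟨l, ⟨-, hl⟩, -⟩ := Complex.isCoveringMapOn_exp.existsUnique_continuousMap_lifts u
    (a₀ := ⟨x₀, hx₀⟩) (e₀ := Complex.log (u ⟨x₀, hx₀⟩)) (Complex.exp_log (hu _)) hu
  exact ⟨l, fun x => congrFun hl x⟩

/-- On a convex set, two continuous logarithms of the same function have the same increments. -/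
theorem sub_eq_sub_of_exp_eq {V : Type*} [NormedAddCommGroup V] [NormedSpace ℝ V]
    {S : Set V} (hconv : Convex ℝ S) (l l' : C(S, ℂ))
    (h : ∀ x, Complex.exp (l x) = Complex.exp (l' x)) (x y : S) : l x - l y = l' x - l' y := by
  have := hconv.contractibleSpace ⟨x, x.2⟩
  have := hconv.locallyPathConnectedSpace
  have hexp : Complex.exp (l y - l' y) = 1 := by
    rw [Complex.exp_sub, h, div_self (Complex.exp_ne_zero _)]
  have h1 : l = ⟨fun x => l' x + (l y - l' y), by fun_prop⟩ :=
    (Complex.isCoveringMapOn_exp.existsUnique_continuousMap_lifts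
      ⟨fun x => Complex.exp (l x), by fun_prop⟩
      (a₀ := y) (e₀ := l y) rfl (fun x => Complex.exp_ne_zero _)).unique
      ⟨rfl, rfl⟩ ⟨by simp, by funext x; simp [Complex.exp_add, hexp, h]⟩
  have h2 := DFunLike.congr_fun h1 x
  simp only [ContinuousMap.coe_mk] at h2
  rw [h2]
  ring

/-! ### The Euler class of the tautological line bundle as a singular cocycle -/

/-- The inclusion of the face of the standard simplex opposite to the vertex `i`. -/
noncomputable def simplexFace {n : ℕ} (i : Fin (n + 2)) :
    C(stdSimplex ℝ (Fin (n + 1)), stdSimplex ℝ (Fin (n + 2))) :=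
  ⟨stdSimplex.map i.succAbove, stdSimplex.continuous_map _⟩

theorem continuous_stdSimplex_apply {ι : Type*} [Fintype ι] (i : ι) :
    Continuous fun x : stdSimplex ℝ ι => (x i : ℂ) :=
  Complex.continuous_ofReal.comp ((continuous_apply i).comp continuous_subtype_val)

theorem simplexFace_vertex {n : ℕ} (i : Fin (n + 2)) (j : Fin (n + 1)) :
    simplexFace i (stdSimplex.vertex j) = stdSimplex.vertex (i.succAbove j) :=
  stdSimplex.map_vertex _ _

theorem simplexFace_comp_eq {n : ℕ} {i i' : Fin (n + 3)} {j j' : Fin (n + 2)}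
    (h : i.succAbove ∘ j.succAbove = i'.succAbove ∘ j'.succAbove) :
    (simplexFace i).comp (simplexFace j) = (simplexFace i').comp (simplexFace j') := by
  ext1 x
  simp only [simplexFace, ContinuousMap.comp_apply, ContinuousMap.coe_mk,
    stdSimplex.map_comp_apply, h]

theorem IsHomogeneousLift.exp_smul {n : ℕ} {K : Type*} {f : K → ComplexProjectiveSpace n}
    {g : K → Fin (n + 1) → ℂ} (hg : IsHomogeneousLift f g) (l : K → ℂ) :
    IsHomogeneousLift f fun x => Complex.exp (l x) • g x := fun x =>
  ⟨smul_ne_zero (Complex.exp_ne_zero _) (hg x).1,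
    ((Projectivization.mk_eq_mk_iff' ℂ _ _ _ (hg x).1).2 ⟨_, rfl⟩).trans (hg x).2⟩

theorem IsHomogeneousLift.comp {n : ℕ} {K K' : Type*} {f : K → ComplexProjectiveSpace n}
    {g : K → Fin (n + 1) → ℂ} (hg : IsHomogeneousLift f g) (q : K' → K) :
    IsHomogeneousLift (f ∘ q) (g ∘ q) := fun x => hg (q x)

theorem IsHomogeneousLift.exists_exp_smul {n : ℕ} {V : Type*} [NormedAddCommGroup V]
    [NormedSpace ℝ V] {S : Set V} (hconv : Convex ℝ S) {f : S → ComplexProjectiveSpace n}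
    {g g' : C(S, Fin (n + 1) → ℂ)} (hg : IsHomogeneousLift f g) (hg' : IsHomogeneousLift f g') :
    ∃ l : C(S, ℂ), ∀ x, g' x = Complex.exp (l x) • g x := by
  obtain ⟨u, hu, h⟩ := hg.exists_smul hg'
  obtain ⟨l, hl⟩ := exists_continuous_log hconv u hu
  exact ⟨l, fun x => by rw [hl, h]⟩

section EulerCocycle

variable {n : ℕ}

theorem exists_exp_smul_rep {p : ComplexProjectiveSpace n} {v : Fin (n + 1) → ℂ} {hv : v ≠ 0}
    (h : Projectivization.mk ℂ v hv = p) : ∃ a : ℂ, v = Complex.exp a • p.rep := by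
  obtain ⟨a, ha⟩ := (Projectivization.mk_eq_mk_iff ℂ _ _ hv p.rep_nonzero).1
    (h.trans p.mk_rep.symm)
  exact ⟨Complex.log a, by rw [Complex.exp_log a.ne_zero, ← ha]; rfl⟩

theorem exists_edgeLift (e : C(stdSimplex ℝ (Fin 2), ComplexProjectiveSpace n)) :
    ∃ g : C(stdSimplex ℝ (Fin 2), Fin (n + 1) → ℂ), IsHomogeneousLift e g ∧
      ∀ i, g (stdSimplex.vertex i) = (e (stdSimplex.vertex i)).rep := by
  obtain ⟨g, hg⟩ := exists_isHomogeneousLift (convex_stdSimplex ℝ _) (isCompact_stdSimplex _ _) e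
  choose a ha using fun i : Fin 2 => exists_exp_smul_rep (hg (stdSimplex.vertex i)).2
  -- Correct the values at the two ends by a factor whose logarithm is affine.
  have hcont := continuous_stdSimplex_apply (ι := Fin 2)
  refine ⟨⟨fun x => Complex.exp (-(x 0 * a 0 + x 1 * a 1)) • g x,
    ((((hcont 0).mul continuous_const).add ((hcont 1).mul continuous_const)).neg.cexp).smul
      g.continuous⟩,
    hg.exp_smul _, fun i => ?_⟩
  simp only [ContinuousMap.coe_mk]
  rw [ha i, smul_smul, ← Complex.exp_add]
  fin_cases i <;> simp

/-- A chosen lift of a path in `ℂP^n` that starts and ends at the chosen representatives of the end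
points of the path. -/
noncomputable def edgeLift (e : C(stdSimplex ℝ (Fin 2), ComplexProjectiveSpace n)) :
    C(stdSimplex ℝ (Fin 2), Fin (n + 1) → ℂ) :=
  (exists_edgeLift e).choose

theorem isHomogeneousLift_edgeLift (e : C(stdSimplex ℝ (Fin 2), ComplexProjectiveSpace n)) :
    IsHomogeneousLift e (edgeLift e) :=
  (exists_edgeLift e).choose_spec.1

theorem edgeLift_vertex (e : C(stdSimplex ℝ (Fin 2), ComplexProjectiveSpace n)) (i : Fin 2) :
    edgeLift e (stdSimplex.vertex i) = (e (stdSimplex.vertex i)).rep :=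
  (exists_edgeLift e).choose_spec.2 i

open Classical in
/-- The increment along a path `e` of a logarithm of the quotient of a lift `g` of `e` by the chosen
lift of `e`. It is `0` if `g` is not a lift of `e`. -/
noncomputable def edgeIncrement (e : C(stdSimplex ℝ (Fin 2), ComplexProjectiveSpace n))
    (g : C(stdSimplex ℝ (Fin 2), Fin (n + 1) → ℂ)) : ℂ :=
  if h : ∃ l : C(stdSimplex ℝ (Fin 2), ℂ), ∀ x, g x = Complex.exp (l x) • edgeLift e x then
    h.choose (stdSimplex.vertex 1) - h.choose (stdSimplex.vertex 0)
  else 0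

theorem edgeIncrement_eq {e : C(stdSimplex ℝ (Fin 2), ComplexProjectiveSpace n)}
    {g : C(stdSimplex ℝ (Fin 2), Fin (n + 1) → ℂ)} (l : C(stdSimplex ℝ (Fin 2), ℂ))
    (hl : ∀ x, g x = Complex.exp (l x) • edgeLift e x) :
    edgeIncrement e g = l (stdSimplex.vertex 1) - l (stdSimplex.vertex 0) := by
  have h : ∃ l : C(stdSimplex ℝ (Fin 2), ℂ), ∀ x, g x = Complex.exp (l x) • edgeLift e x := ⟨l, hl⟩
  rw [edgeIncrement, dif_pos h]
  refine sub_eq_sub_of_exp_eq (convex_stdSimplex ℝ _) _ _ (fun x => ?_) _ _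
  exact smul_left_injective ℂ (isHomogeneousLift_edgeLift e x).1
    ((h.choose_spec x).symm.trans (hl x))

theorem edgeIncrement_exp_smul {e : C(stdSimplex ℝ (Fin 2), ComplexProjectiveSpace n)}
    {g g' : C(stdSimplex ℝ (Fin 2), Fin (n + 1) → ℂ)} (hg : IsHomogeneousLift e g)
    (l : C(stdSimplex ℝ (Fin 2), ℂ)) (hl : ∀ x, g' x = Complex.exp (l x) • g x) :
    edgeIncrement e g' =
      edgeIncrement e g + (l (stdSimplex.vertex 1) - l (stdSimplex.vertex 0)) := by
  obtain ⟨m, hm⟩ := (isHomogeneousLift_edgeLift e).exists_exp_smul (convex_stdSimplex ℝ _) hg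
  rw [edgeIncrement_eq m hm, edgeIncrement_eq (l + m) fun x => by
    rw [hl, hm, smul_smul, ContinuousMap.add_apply, Complex.exp_add]]
  simp only [ContinuousMap.add_apply]
  ring

/-- Up to a multiple of `2πi`, the increment only depends on the values of the lift at the end
points. -/
theorem exp_edgeIncrement {e : C(stdSimplex ℝ (Fin 2), ComplexProjectiveSpace n)}
    {g : C(stdSimplex ℝ (Fin 2), Fin (n + 1) → ℂ)} (hg : IsHomogeneousLift e g) {a : Fin 2 → ℂ}
    (ha : ∀ i, g (stdSimplex.vertex i) = Complex.exp (a i) • (e (stdSimplex.vertex i)).rep) :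
    Complex.exp (edgeIncrement e g) = Complex.exp (a 1 - a 0) := by
  obtain ⟨m, hm⟩ := (isHomogeneousLift_edgeLift e).exists_exp_smul (convex_stdSimplex ℝ _) hg
  have h : ∀ i, Complex.exp (m (stdSimplex.vertex i)) = Complex.exp (a i) := fun i => by
    refine smul_left_injective ℂ (e (stdSimplex.vertex i)).rep_nonzero ?_
    simp only
    rw [← ha, ← edgeLift_vertex, ← hm]
  rw [edgeIncrement_eq m hm, Complex.exp_sub, Complex.exp_sub, h, h]

/-- The total increment along the boundary of a `2`-simplex `σ`, for a lift `g` of `σ`. -/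
noncomputable def boundaryIncrement (σ : C(stdSimplex ℝ (Fin 3), ComplexProjectiveSpace n))
    (g : C(stdSimplex ℝ (Fin 3), Fin (n + 1) → ℂ)) : ℂ :=
  edgeIncrement (σ.comp (simplexFace 0)) (g.comp (simplexFace 0)) -
    edgeIncrement (σ.comp (simplexFace 1)) (g.comp (simplexFace 1)) +
    edgeIncrement (σ.comp (simplexFace 2)) (g.comp (simplexFace 2))

theorem boundaryIncrement_congr {σ : C(stdSimplex ℝ (Fin 3), ComplexProjectiveSpace n)}
    {g g' : C(stdSimplex ℝ (Fin 3), Fin (n + 1) → ℂ)} (hg : IsHomogeneousLift σ g)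
    (hg' : IsHomogeneousLift σ g') : boundaryIncrement σ g = boundaryIncrement σ g' := by
  obtain ⟨l, hl⟩ := hg'.exists_exp_smul (convex_stdSimplex ℝ _) hg
  have h : ∀ i, edgeIncrement (σ.comp (simplexFace i)) (g.comp (simplexFace i)) =
      edgeIncrement (σ.comp (simplexFace i)) (g'.comp (simplexFace i)) +
        (l (stdSimplex.vertex (i.succAbove 1)) - l (stdSimplex.vertex (i.succAbove 0))) := by
    intro i
    rw [edgeIncrement_exp_smul (g := g'.comp (simplexFace i)) (hg'.comp (simplexFace i))
      (l.comp (simplexFace i)) fun x => hl _,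
      ContinuousMap.comp_apply, ContinuousMap.comp_apply, simplexFace_vertex, simplexFace_vertex]
  simp only [boundaryIncrement, h]
  simp [Fin.succAbove]
  ring

theorem exists_int_boundaryIncrement {σ : C(stdSimplex ℝ (Fin 3), ComplexProjectiveSpace n)}
    {g : C(stdSimplex ℝ (Fin 3), Fin (n + 1) → ℂ)} (hg : IsHomogeneousLift σ g) :
    ∃ k : ℤ, boundaryIncrement σ g = k * (2 * Real.pi * Complex.I) := by
  choose a ha using fun i : Fin 3 => exists_exp_smul_rep (hg (stdSimplex.vertex i)).2
  have h : ∀ i, Complex.exp (edgeIncrement (σ.comp (simplexFace i)) (g.comp (simplexFace i))) =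
      Complex.exp (a (i.succAbove 1) - a (i.succAbove 0)) := fun i =>
    exp_edgeIncrement (a := fun j => a (i.succAbove j)) (hg.comp (simplexFace i)) fun j => by
      rw [ContinuousMap.comp_apply, ContinuousMap.comp_apply, simplexFace_vertex, ha]
  rw [← Complex.exp_eq_one_iff, boundaryIncrement, Complex.exp_add, Complex.exp_sub, h, h, h,
    ← Complex.exp_sub, ← Complex.exp_add, Complex.exp_eq_one_iff]
  refine ⟨0, ?_⟩
  simp [Fin.succAbove]

/-- Every `2`-simplex has a lift, and the total increment of a lift along the boundary is an integral
multiple of `2πi` that does not depend on the lift. -/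
theorem exists_eulerCocycle (σ : C(stdSimplex ℝ (Fin 3), ComplexProjectiveSpace n)) :
    ∃ k : ℤ, ∀ g : C(stdSimplex ℝ (Fin 3), Fin (n + 1) → ℂ), IsHomogeneousLift σ g →
      boundaryIncrement σ g = k * (2 * Real.pi * Complex.I) := by
  obtain ⟨g, hg⟩ := exists_isHomogeneousLift (convex_stdSimplex ℝ _) (isCompact_stdSimplex _ _) σ
  obtain ⟨k, hk⟩ := exists_int_boundaryIncrement hg
  exact ⟨k, fun g' hg' => (boundaryIncrement_congr hg' hg).trans hk⟩

/-- A singular cocycle of degree `2` on `ℂP^n` with integral values that represents, up to sign, the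
Euler class of the tautological line bundle: on a simplex `σ` it is the
winding number of a lift of `σ` along the boundary, relative to the chosen lifts of the edges. -/
noncomputable def eulerCocycle (σ : C(stdSimplex ℝ (Fin 3), ComplexProjectiveSpace n)) : ℤ :=
  (exists_eulerCocycle σ).choose

theorem boundaryIncrement_eq {σ : C(stdSimplex ℝ (Fin 3), ComplexProjectiveSpace n)}
    {g : C(stdSimplex ℝ (Fin 3), Fin (n + 1) → ℂ)} (hg : IsHomogeneousLift σ g) :
    boundaryIncrement σ g = eulerCocycle σ * (2 * Real.pi * Complex.I) :=
  (exists_eulerCocycle σ).choose_spec g hg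

/-- The cocycle condition: all four faces of a `3`-simplex can be computed with the restrictions of
one lift, and then each edge is counted twice with opposite signs. -/
theorem eulerCocycle_alternating_sum (τ : C(stdSimplex ℝ (Fin 4), ComplexProjectiveSpace n)) :
    eulerCocycle (τ.comp (simplexFace 0)) - eulerCocycle (τ.comp (simplexFace 1)) +
      eulerCocycle (τ.comp (simplexFace 2)) - eulerCocycle (τ.comp (simplexFace 3)) = 0 := by
  obtain ⟨g, hg⟩ := exists_isHomogeneousLift (convex_stdSimplex ℝ _) (isCompact_stdSimplex _ _) τ
  have h : ∀ i, boundaryIncrement (τ.comp (simplexFace i)) (g.comp (simplexFace i)) =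
      eulerCocycle (τ.comp (simplexFace i)) * (2 * Real.pi * Complex.I) := fun i =>
    boundaryIncrement_eq (hg.comp (simplexFace i))
  have hsum : boundaryIncrement (τ.comp (simplexFace 0)) (g.comp (simplexFace 0)) -
      boundaryIncrement (τ.comp (simplexFace 1)) (g.comp (simplexFace 1)) +
      boundaryIncrement (τ.comp (simplexFace 2)) (g.comp (simplexFace 2)) -
      boundaryIncrement (τ.comp (simplexFace 3)) (g.comp (simplexFace 3)) = 0 := by
    simp only [boundaryIncrement, ContinuousMap.comp_assoc]
    rw [simplexFace_comp_eq (i := 1) (j := 0) (i' := 0) (j' := 0) (by decide),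
      simplexFace_comp_eq (i := 2) (j := 0) (i' := 0) (j' := 1) (by decide),
      simplexFace_comp_eq (i := 3) (j := 0) (i' := 0) (j' := 2) (by decide),
      simplexFace_comp_eq (i := 2) (j := 1) (i' := 1) (j' := 1) (by decide),
      simplexFace_comp_eq (i := 3) (j := 1) (i' := 1) (j' := 2) (by decide),
      simplexFace_comp_eq (i := 3) (j := 2) (i' := 2) (j' := 2) (by decide)]
    ring
  simp only [h, ← sub_mul, ← add_mul] at hsum
  exact_mod_cast (mul_eq_zero.1 hsum).resolve_right Complex.two_pi_I_ne_zero

theorem sum_eulerCocycle_mod_two (τ : C(stdSimplex ℝ (Fin 4), ComplexProjectiveSpace n)) :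
    ∑ i, (eulerCocycle (τ.comp (simplexFace i)) : ZMod 2) = 0 := by
  have h := congrArg (Int.cast : ℤ → ZMod 2) (eulerCocycle_alternating_sum τ)
  push_cast [CharTwo.sub_eq_add] at h
  rwa [Fin.sum_univ_four]

/-- The difference of the values of the cocycle at a simplex with collapsed boundary and at the
constant simplex is a winding number. -/
theorem eulerCocycle_sub_eulerCocycle_const
    {σ : C(stdSimplex ℝ (Fin 3), ComplexProjectiveSpace n)}
    {g : C(stdSimplex ℝ (Fin 3), Fin (n + 1) → ℂ)} (hg : IsHomogeneousLift σ g)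
    {v : Fin (n + 1) → ℂ} (hv : v ≠ 0) (l : Fin 3 → C(stdSimplex ℝ (Fin 2), ℂ))
    (hl : ∀ i x, g (simplexFace i x) = Complex.exp (l i x) • v) :
    ((eulerCocycle σ - eulerCocycle (.const _ (Projectivization.mk ℂ v hv)) : ℤ) : ℂ) *
        (2 * Real.pi * Complex.I) =
      (l 0 (stdSimplex.vertex 1) - l 0 (stdSimplex.vertex 0)) -
      (l 1 (stdSimplex.vertex 1) - l 1 (stdSimplex.vertex 0)) +
      (l 2 (stdSimplex.vertex 1) - l 2 (stdSimplex.vertex 0)) := by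
  have hconst : IsHomogeneousLift (ContinuousMap.const (stdSimplex ℝ (Fin 3))
      (Projectivization.mk ℂ v hv)) (ContinuousMap.const (stdSimplex ℝ (Fin 3)) v) :=
    fun x => ⟨hv, rfl⟩
  have hface : ∀ i,
      σ.comp (simplexFace i) = ContinuousMap.const _ (Projectivization.mk ℂ v hv) := by
    intro i
    ext1 x
    obtain ⟨h1, h2⟩ := hg (simplexFace i x)
    refine h2.symm.trans ((Projectivization.mk_eq_mk_iff' ℂ _ _ h1 hv).2 ⟨_, (hl i x).symm⟩)
  have hedge : ∀ i, edgeIncrement (σ.comp (simplexFace i)) (g.comp (simplexFace i)) =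
      edgeIncrement (.const _ (Projectivization.mk ℂ v hv)) (.const _ v) +
        (l i (stdSimplex.vertex 1) - l i (stdSimplex.vertex 0)) := by
    intro i
    rw [hface]
    exact edgeIncrement_exp_smul (fun x => ⟨hv, rfl⟩) (l i) (hl i)
  push_cast
  rw [sub_mul, ← boundaryIncrement_eq hg, ← boundaryIncrement_eq hconst]
  simp only [boundaryIncrement, hedge, ContinuousMap.const_comp]
  ring

end EulerCocycle

/-! ### Detecting nontrivial maps on mod 2 cohomology -/

/-- If `f` induces the identity on homology, then precomposition with a cycle `k` and
postcomposition with a map `e` that kills boundaries do not distinguish `f` from the identity. -/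
theorem HomologicalComplex.comp_f_comp_eq_of_homologyMap_eq_id {C : Type*} [Category C]
    [Abelian C] {ι : Type*} {c : ComplexShape ι} {K : HomologicalComplex C c} (f : K ⟶ K)
    (i j l : ι) (hj : c.next i = j) (hl : c.prev i = l) (hf : homologyMap f i = 𝟙 _)
    {A B : C} (k : A ⟶ K.X i) (hk : k ≫ K.d i j = 0) (e : K.X i ⟶ B) (he : K.d l i ≫ e = 0) :
    k ≫ f.f i ≫ e = k ≫ e := by
  have h1 : K.liftCycles k j hj hk ≫ K.homologyπ i ≫ homologyMap f i ≫ K.homologyι i ≫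
      K.descOpcycles e l hl he = k ≫ f.f i ≫ e := by
    simp
  have h2 : K.liftCycles k j hj hk ≫ K.homologyπ i ≫ K.homologyι i ≫
      K.descOpcycles e l hl he = k ≫ e := by
    simp
  rw [← h1, ← h2, hf, Category.id_comp]

/-- The singular chain complex with mod 2 coefficients. -/
noncomputable abbrev mod2Chains (X : TopCat.{0}) : ChainComplex (ModuleCat.{0} (ZMod 2)) ℕ :=
  (TopCat.toSSet.obj X).chainComplex (ModuleCat.of (ZMod 2) (ZMod 2))

/-- If `f` induces the identity on mod 2 cohomology, then a cocycle `φ` does not distinguish a cycle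
`z` from its image under `f`. -/
theorem comp_eq_of_mod2CohomologyMap_eq_id {X : Type} [TopologicalSpace X] (f : C(X, X))
    (hf : mod2CohomologyMap f = 𝟙 _) (n : ℕ)
    (φ : (mod2Chains (TopCat.of X)).X (n + 1) ⟶ ModuleCat.of (ZMod 2) (ZMod 2))
    (hφ : (mod2Chains (TopCat.of X)).d (n + 2) (n + 1) ≫ φ = 0)
    (z : ModuleCat.of (ZMod 2) (ZMod 2) ⟶ (mod2Chains (TopCat.of X)).X (n + 1))
    (hz : z ≫ (mod2Chains (TopCat.of X)).d (n + 1) n = 0) :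
    z ≫ (SSet.chainComplexMap (TopCat.toSSet.map (TopCat.ofHom f))
      (ModuleCat.of (ZMod 2) (ZMod 2))).f (n + 1) ≫ φ = z ≫ φ := by
  have h := HomologicalComplex.comp_f_comp_eq_of_homologyMap_eq_id
    (mod2CochainComplex.map (TopCat.ofHom f).op) (n + 1) (n + 2) n
    (ComplexShape.next_eq' _ rfl) (ComplexShape.prev_eq' _ rfl) (congrFun hf (n + 1))
    (A := ModuleCat.of (ZMod 2) (ZMod 2))
    (ModuleCat.ofHom (LinearMap.toSpanSingleton (ZMod 2)
      ((mod2Chains (TopCat.of X)).X (n + 1) ⟶ ModuleCat.of (ZMod 2) (ZMod 2)) φ))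
    (by
      ext
      change (mod2Chains (TopCat.of X)).d (n + 2) (n + 1) ≫ ((1 : ZMod 2) • φ) = 0
      rw [one_smul, hφ])
    (((linearYoneda (ZMod 2) (ModuleCat.{0} (ZMod 2))).obj
      (ModuleCat.of (ZMod 2) (ZMod 2))).map z.op)
    (by
      ext ψ : 2
      change (mod2Chains (TopCat.of X)).X n ⟶ ModuleCat.of (ZMod 2) (ZMod 2) at ψ
      change z ≫ (mod2Chains (TopCat.of X)).d (n + 1) n ≫ ψ = 0
      rw [reassoc_of% hz, Limits.zero_comp])
  have h2 := congrArg (fun q => q.hom (1 : ZMod 2)) h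
  change z ≫ (SSet.chainComplexMap (TopCat.toSSet.map (TopCat.ofHom f))
      (ModuleCat.of (ZMod 2) (ZMod 2))).f (n + 1) ≫ ((1 : ZMod 2) • φ) =
      z ≫ ((1 : ZMod 2) • φ) at h2
  rwa [one_smul] at h2

/-- The mod 2 cochain with prescribed values on the singular simplices. -/
noncomputable def mod2Cochain (X : SSet.{0}) (n : ℕ) (c : X.obj (.op (.mk n)) → ZMod 2) :
    (X.chainComplex (ModuleCat.of (ZMod 2) (ZMod 2))).X n ⟶ ModuleCat.of (ZMod 2) (ZMod 2) :=
  (X.isColimitChainComplexXCofan (ModuleCat.of (ZMod 2) (ZMod 2)) n).desc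
    (Limits.Cofan.mk _ fun x => c x • 𝟙 _)

theorem ι_mod2Cochain (X : SSet.{0}) (n : ℕ) (c : X.obj (.op (.mk n)) → ZMod 2)
    (x : X.obj (.op (.mk n))) : X.ιChainComplex x ≫ mod2Cochain X n c = c x • 𝟙 _ :=
  (X.isColimitChainComplexXCofan (ModuleCat.of (ZMod 2) (ZMod 2)) n).fac _ ⟨x⟩

/-- If `f` induces the identity on mod 2 cohomology, then a cocycle `c` has the same value on the
cycle `σ + κ` as on its image under `f`. The chain `σ + κ` is a mod 2 cycle because `σ` and `κ` have
the same faces. -/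
theorem add_eq_add_of_mod2CohomologyMap_eq_id {X : Type} [TopologicalSpace X] (f : C(X, X))
    (hf : mod2CohomologyMap f = 𝟙 _) (n : ℕ) (c : C(stdSimplex ℝ (Fin (n + 2)), X) → ZMod 2)
    (hc : ∀ τ : C(stdSimplex ℝ (Fin (n + 3)), X), ∑ i, c (τ.comp (simplexFace i)) = 0)
    (σ κ : C(stdSimplex ℝ (Fin (n + 2)), X))
    (h : ∀ i, σ.comp (simplexFace i) = κ.comp (simplexFace i)) :
    c (f.comp σ) + c (f.comp κ) = c σ + c κ := by
  let S := TopCat.toSSet.obj (TopCat.of X)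
  let e (m : ℕ) : S.obj (.op (.mk m)) ≃ C(stdSimplex ℝ (Fin (m + 1)), X) :=
    (TopCat.of X).toSSetObjEquiv (.op (.mk m))
  have htwo : ∀ {A B : ModuleCat.{0} (ZMod 2)} (q : A ⟶ B), q + q = 0 := fun q => by
    rw [← two_smul (ZMod 2) q, show (2 : ZMod 2) = 0 from rfl, zero_smul]
  have hsign : ∀ {A B : ModuleCat.{0} (ZMod 2)} (i : ℕ) (q : A ⟶ B), (-1) ^ i • q = q := by
    intro A B i q
    rcases neg_one_pow_eq_or ℤ i with h | h <;> rw [h]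
    · simp
    · rw [neg_one_smul, neg_eq_iff_add_eq_zero, htwo]
  have key := comp_eq_of_mod2CohomologyMap_eq_id f hf n (mod2Cochain S (n + 1) (c ∘ e (n + 1)))
    (by
      refine SSet.chainComplex_hom_ext fun x => ?_
      rw [SSet.ιChainComplex_d_assoc, Preadditive.sum_comp, Limits.comp_zero]
      simp only [hsign]
      refine (Finset.sum_congr rfl fun i _ => ι_mod2Cochain S (n + 1) _ _).trans ?_
      rw [← Finset.sum_smul]
      exact (congrArg (· • 𝟙 _) (hc (e (n + 2) x))).trans (zero_smul _ _))
    (S.ιChainComplex ((e (n + 1)).symm σ) + S.ιChainComplex ((e (n + 1)).symm κ))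
    (by
      rw [Preadditive.add_comp, SSet.ιChainComplex_d, SSet.ιChainComplex_d,
        ← Finset.sum_add_distrib]
      refine Finset.sum_eq_zero fun i _ => ?_
      have : S.δ i ((e (n + 1)).symm σ) = S.δ i ((e (n + 1)).symm κ) :=
        congrArg (e n).symm (h i)
      rw [this, htwo])
  have himage : ∀ x, S.ιChainComplex x ≫
      (SSet.chainComplexMap (TopCat.toSSet.map (TopCat.ofHom f))
        (ModuleCat.of (ZMod 2) (ZMod 2))).f (n + 1) ≫ mod2Cochain S (n + 1) (c ∘ e (n + 1)) =
      c (f.comp (e (n + 1) x)) • 𝟙 _ := fun x => by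
    rw [SSet.ι_chainComplexMap_f_assoc]
    exact ι_mod2Cochain S (n + 1) _ _
  rw [Preadditive.add_comp, Preadditive.add_comp, himage, himage, ι_mod2Cochain,
    ι_mod2Cochain, ← add_smul, ← add_smul] at key
  have key2 := congrArg (fun q => q.hom (1 : ZMod 2)) key
  simpa only [ModuleCat.hom_smul, LinearMap.smul_apply, ModuleCat.hom_id, LinearMap.id_apply,
    smul_eq_mul, mul_one, Function.comp_apply, Equiv.apply_symm_apply] using key2

/-! ### A singular sphere in the Milnor manifold -/

section MilnorManifold

variable {n : ℕ}

theorem simplexFace_apply_succAbove {m : ℕ} (i : Fin (m + 2)) (x : stdSimplex ℝ (Fin (m + 1)))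
    (j : Fin (m + 1)) : simplexFace i x (i.succAbove j) = x j := by
  simp [simplexFace, FunOnFinite.linearMap_apply_apply, Finset.filter_eq']

theorem simplexFace_apply_self {m : ℕ} (i : Fin (m + 2)) (x : stdSimplex ℝ (Fin (m + 1))) :
    simplexFace i x i = 0 := by
  simp [simplexFace, FunOnFinite.linearMap_apply_apply, Fin.succAbove_ne]

/-- A logarithm along the segment from `1` to a nonreal number. -/
theorem exists_log_segment {η : ℂ} (hη : η.im ≠ 0) :
    ∃ l : C(stdSimplex ℝ (Fin 2), ℂ), (∀ x, Complex.exp (l x) = x 0 + x 1 * η) ∧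
      l (stdSimplex.vertex 1) - l (stdSimplex.vertex 0) = Complex.log η := by
  have hmem : ∀ x : stdSimplex ℝ (Fin 2), (x 0 + x 1 * η : ℂ) ∈ Complex.slitPlane := by
    intro x
    by_cases h : x 1 = 0
    · have := stdSimplex.add_eq_one x
      rw [h, add_zero] at this
      simp [h, this]
    · exact Complex.mem_slitPlane_iff.2 (.inr (by simp [h, hη]))
  have hcont := continuous_stdSimplex_apply (ι := Fin 2)
  refine ⟨⟨fun x => Complex.log (x 0 + x 1 * η),
      ((hcont 0).add ((hcont 1).mul continuous_const)).clog hmem⟩,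
    fun x => Complex.exp_log (Complex.slitPlane_ne_zero (hmem x)), by simp⟩

/-- The affine map from the triangle to the complex plane that sends the vertices to the third roots
of unity. -/
noncomputable def triangleMap (x : stdSimplex ℝ (Fin 3)) : ℂ :=
  x 0 + x 1 * Complex.exp ((2 * Real.pi / 3 : ℝ) * Complex.I) +
    x 2 * Complex.exp ((-(2 * Real.pi / 3) : ℝ) * Complex.I)

theorem continuous_triangleMap : Continuous triangleMap := by
  have hcont := continuous_stdSimplex_apply (ι := Fin 3)
  exact ((hcont 0).add ((hcont 1).mul continuous_const)).add ((hcont 2).mul continuous_const)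

theorem sin_two_pi_div_three_pos : 0 < Real.sin (2 * Real.pi / 3) :=
  Real.sin_pos_of_pos_of_lt_pi (by positivity) (by linarith [Real.pi_pos])

/-- The only zero of `triangleMap` is the barycenter. -/
theorem prod_ne_zero_of_triangleMap_eq_zero {x : stdSimplex ℝ (Fin 3)} (h : triangleMap x = 0) :
    x 0 * x 1 * x 2 ≠ 0 := by
  have hsin := sin_two_pi_div_three_pos
  have hcos : Real.cos (2 * Real.pi / 3) = -1 / 2 := by
    rw [show 2 * Real.pi / 3 = Real.pi - Real.pi / 3 by ring, Real.cos_pi_sub,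
      Real.cos_pi_div_three]
    norm_num
  have hre := congrArg Complex.re h
  have him := congrArg Complex.im h
  simp only [triangleMap, Complex.add_re, Complex.ofReal_re, Complex.re_ofReal_mul,
    Complex.exp_ofReal_mul_I_re, Real.cos_neg, hcos, Complex.zero_re] at hre
  simp only [triangleMap, Complex.add_im, Complex.ofReal_im, Complex.im_ofReal_mul,
    Complex.exp_ofReal_mul_I_im, Real.sin_neg, Complex.zero_im] at him
  have h12 : x 1 = x 2 := by
    have : (x 1 - x 2) * Real.sin (2 * Real.pi / 3) = 0 := by linarith
    exact sub_eq_zero.1 ((mul_eq_zero.1 this).resolve_right hsin.ne')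
  have hsum := stdSimplex.sum_eq_one x
  rw [Fin.sum_univ_three] at hsum
  have h0 : x 0 = 1 / 3 := by linarith
  have h1 : x 1 = 1 / 3 := by linarith
  have h2 : x 2 = 1 / 3 := by linarith
  rw [h0, h1, h2]
  norm_num

/-- Along the boundary, `triangleMap` has winding number `1` around the origin. -/
theorem exists_log_triangleMap :
    ∃ l : Fin 3 → C(stdSimplex ℝ (Fin 2), ℂ),
      (∀ i x, Complex.exp (l i x) = triangleMap (simplexFace i x)) ∧
      (l 0 (stdSimplex.vertex 1) - l 0 (stdSimplex.vertex 0)) -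
        (l 1 (stdSimplex.vertex 1) - l 1 (stdSimplex.vertex 0)) +
        (l 2 (stdSimplex.vertex 1) - l 2 (stdSimplex.vertex 0)) = 2 * Real.pi * Complex.I := by
  have hsin := sin_two_pi_div_three_pos
  have hlog : ∀ t : ℝ, -Real.pi < t → t ≤ Real.pi →
      Complex.log (Complex.exp (t * Complex.I)) = t * Complex.I := fun t h1 h2 =>
    Complex.log_exp (by simpa using h1) (by simpa using h2)
  have hpi := Real.pi_pos
  obtain ⟨l₁, hl₁, hl₁'⟩ := exists_log_segment
    (η := Complex.exp ((2 * Real.pi / 3 : ℝ) * Complex.I))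
    (by rw [Complex.exp_ofReal_mul_I_im]; exact hsin.ne')
  obtain ⟨l₂, hl₂, hl₂'⟩ := exists_log_segment
    (η := Complex.exp ((-(2 * Real.pi / 3) : ℝ) * Complex.I))
    (by rw [Complex.exp_ofReal_mul_I_im, Real.sin_neg]; exact (neg_neg_of_pos hsin).ne)
  rw [hlog _ (by linarith) (by linarith)] at hl₁' hl₂'
  have hsq : Complex.exp ((2 * Real.pi / 3 : ℝ) * Complex.I) *
      Complex.exp ((2 * Real.pi / 3 : ℝ) * Complex.I) =
      Complex.exp ((-(2 * Real.pi / 3) : ℝ) * Complex.I) := by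
    rw [← Complex.exp_add, Complex.exp_eq_exp_iff_exists_int]
    exact ⟨1, by push_cast; ring⟩
  have hface : ∀ (i : Fin 3) (x : stdSimplex ℝ (Fin 2)), simplexFace i x i = 0 ∧
      simplexFace i x (i.succAbove 0) = x 0 ∧ simplexFace i x (i.succAbove 1) = x 1 := fun i x =>
    ⟨simplexFace_apply_self i x, simplexFace_apply_succAbove i x 0,
      simplexFace_apply_succAbove i x 1⟩
  -- The edge from the second to the third vertex is the edge from the first to the second one,
  -- rotated by a third of a turn.
  refine ⟨![⟨fun x => (2 * Real.pi / 3 : ℝ) * Complex.I + l₁ x, by fun_prop⟩, l₂, l₁], ?_, ?_⟩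
  · intro i x
    have h := hface i x
    fin_cases i
    · obtain ⟨h0, h1, h2⟩ := h
      change simplexFace 0 x 0 = 0 at h0
      change simplexFace 0 x 1 = x 0 at h1
      change simplexFace 0 x 2 = x 1 at h2
      change Complex.exp (_ + l₁ x) = triangleMap (simplexFace 0 x)
      rw [Complex.exp_add, hl₁, triangleMap, h0, h1, h2, ← hsq]
      push_cast
      ring
    · obtain ⟨h1, h0, h2⟩ := h
      change simplexFace 1 x 1 = 0 at h1
      change simplexFace 1 x 0 = x 0 at h0
      change simplexFace 1 x 2 = x 1 at h2
      change Complex.exp (l₂ x) = triangleMap (simplexFace 1 x)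
      rw [hl₂, triangleMap, h0, h1, h2]
      push_cast
      ring
    · obtain ⟨h2, h0, h1⟩ := h
      change simplexFace 2 x 2 = 0 at h2
      change simplexFace 2 x 0 = x 0 at h0
      change simplexFace 2 x 1 = x 1 at h1
      change Complex.exp (l₁ x) = triangleMap (simplexFace 2 x)
      rw [hl₁, triangleMap, h0, h1, h2]
      push_cast
      ring
  · change (_ + l₁ _ - (_ + l₁ _)) - (l₂ _ - l₂ _) + (l₁ _ - l₁ _) = _
    rw [add_sub_add_left_eq_sub, hl₁', hl₂']
    push_cast
    ring

/-- The vector of `ℂ^(n+1)` with `triangleMap x` in place `a` and the product of the barycentric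
coordinates, which vanishes exactly on the boundary of the triangle, in place `b`. -/
noncomputable def sphereVector (a b : Fin (n + 1)) (x : stdSimplex ℝ (Fin 3)) : Fin (n + 1) → ℂ :=
  Pi.single a (triangleMap x) + Pi.single b (x 0 * x 1 * x 2 : ℂ)

theorem continuous_sphereVector (a b : Fin (n + 1)) : Continuous (sphereVector a b) := by
  have hcont := continuous_stdSimplex_apply (ι := Fin 3)
  have h := continuous_triangleMap
  exact ((continuous_single a).comp h).add 
    ((continuous_single b).comp (((hcont 0).mul (hcont 1)).mul (hcont 2)))

theorem sphereVector_ne_zero {a b : Fin (n + 1)} (hab : a ≠ b) (x : stdSimplex ℝ (Fin 3)) :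
    sphereVector a b x ≠ 0 := by
  intro h
  have ha := congrFun h a
  have hb := congrFun h b
  simp only [sphereVector, Pi.add_apply, Pi.single_eq_same, Pi.single_eq_of_ne hab,
    Pi.single_eq_of_ne hab.symm, add_zero, zero_add, Pi.zero_apply] at ha hb
  exact prod_ne_zero_of_triangleMap_eq_zero ha (by exact_mod_cast hb)

theorem sphereVector_simplexFace (a b : Fin (n + 1)) (i : Fin 3) (x : stdSimplex ℝ (Fin 2)) :
    sphereVector a b (simplexFace i x) = triangleMap (simplexFace i x) • Pi.single a 1 := by
  have h : (simplexFace i x 0 * simplexFace i x 1 * simplexFace i x 2 : ℂ) = 0 := by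
    have := simplexFace_apply_self i x
    fin_cases i <;> simp_all
  rw [sphereVector, h, Pi.single_zero, add_zero, ← Pi.single_smul, smul_eq_mul,
    mul_one]

/-- The triangle with collapsed boundary, as a singular simplex that covers the projective line
spanned by the coordinates `a` and `b`. -/
noncomputable def sphereSimplex {a b : Fin (n + 1)} (hab : a ≠ b) :
    C(stdSimplex ℝ (Fin 3), ComplexProjectiveSpace n) where
  toFun x := Projectivization.mk ℂ (sphereVector a b x) (sphereVector_ne_zero hab x)
  continuous_toFun := continuous_coinduced_rng.comp
    ((continuous_sphereVector a b).subtype_mk (sphereVector_ne_zero hab))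

/-- The point of `ℂP^n` whose only nonzero coordinate is the coordinate `a`. -/
noncomputable def coordinatePoint (a : Fin (n + 1)) : ComplexProjectiveSpace n :=
  Projectivization.mk ℂ (Pi.single a 1) (by simp)

theorem sphereSimplex_simplexFace {a b : Fin (n + 1)} (hab : a ≠ b) (i : Fin 3)
    (x : stdSimplex ℝ (Fin 2)) : sphereSimplex hab (simplexFace i x) = coordinatePoint a :=
  (Projectivization.mk_eq_mk_iff' ℂ _ _ _ _).2 ⟨_, (sphereVector_simplexFace a b i x).symm⟩

theorem eulerCocycle_sphereSimplex {a b : Fin (n + 1)} (hab : a ≠ b) :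
    eulerCocycle (sphereSimplex hab) - eulerCocycle (.const _ (coordinatePoint a)) = 1 := by
  obtain ⟨l, hl, hsum⟩ := exists_log_triangleMap
  have h := eulerCocycle_sub_eulerCocycle_const (σ := sphereSimplex hab)
    (g := ⟨sphereVector a b, continuous_sphereVector a b⟩)
    (fun x => ⟨sphereVector_ne_zero hab x, rfl⟩) (v := Pi.single a 1) (by simp) l
    (fun i x => by rw [hl]; exact sphereVector_simplexFace a b i x)
  rw [hsum] at h
  exact_mod_cast mul_right_cancel₀ Complex.two_pi_I_ne_zero (h.trans (one_mul _).symm)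

theorem mk_coordinatePoint_mem_milnorSet {z : Fin (n + 1) → ℂ} (hz : z ≠ 0) {c : Fin (n + 1)}
    (h : z c = 0) : (Projectivization.mk ℂ z hz, coordinatePoint c) ∈ milnorSet n n le_rfl := by
  rw [coordinatePoint, mk_mem_milnorSet]
  refine Finset.sum_eq_zero fun i _ => ?_
  by_cases hi : i = c
  · subst hi
    simp [h]
  · simp [hi]

theorem milnorSwap_ne_self (p : ComplexMilnorManifold n n le_rfl) : milnorSwap n p ≠ p := by
  intro h
  have h1 : p.1.2 = p.1.1 := congrArg (fun q => q.1.1) h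
  have h2 := p.2
  simp only [milnorSet, Set.mem_ofPred_eq, Fin.castLE_rfl, id_eq, h1] at h2
  refine star_dotProduct_self_ne_zero p.1.1.rep_nonzero ?_
  rw [dotProduct_comm]
  exact h2

theorem mod2CohomologyMap_milnorSwap_ne_id (hn : 2 ≤ n) :
    mod2CohomologyMap (milnorSwap n) ≠ 𝟙 _ := by
  intro hid
  have hab : (⟨0, by omega⟩ : Fin (n + 1)) ≠ ⟨1, by omega⟩ := by simp
  let a : Fin (n + 1) := ⟨0, by omega⟩
  let c : Fin (n + 1) := Fin.last n
  have hac : c ≠ a := by simp [a, c, Fin.ext_iff]; omega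
  have hbc : c ≠ ⟨1, by omega⟩ := by simp [c, Fin.ext_iff]; omega
  let σ : C(stdSimplex ℝ (Fin 3), ComplexMilnorManifold n n le_rfl) :=
    ⟨fun x => ⟨(sphereSimplex hab x, coordinatePoint c), mk_coordinatePoint_mem_milnorSet _ (by
      rw [sphereVector, Pi.add_apply, Pi.single_eq_of_ne hac, Pi.single_eq_of_ne hbc, add_zero])⟩,
      by fun_prop⟩
  let κ : C(stdSimplex ℝ (Fin 3), ComplexMilnorManifold n n le_rfl) :=
    .const _ ⟨(coordinatePoint a, coordinatePoint c), mk_coordinatePoint_mem_milnorSet _ (by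
      simp [hac])⟩
  let pr : C(ComplexMilnorManifold n n le_rfl, ComplexProjectiveSpace n) :=
    ⟨fun p => p.1.1, by fun_prop⟩
  have key := add_eq_add_of_mod2CohomologyMap_eq_id (milnorSwap n) hid 1
    (fun τ => (eulerCocycle (pr.comp τ) : ZMod 2))
    (fun τ => sum_eulerCocycle_mod_two (pr.comp τ)) σ κ
    (fun i => by
      ext1 x
      exact Subtype.ext (Prod.ext (sphereSimplex_simplexFace hab i x) rfl))
  -- After the swap both simplices have constant first component.
  have hσ : pr.comp ((milnorSwap n).comp σ) = .const _ (coordinatePoint c) := rfl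
  have hκ : pr.comp ((milnorSwap n).comp κ) = .const _ (coordinatePoint c) := rfl
  have hσ' : pr.comp σ = sphereSimplex hab := rfl
  have hκ' : pr.comp κ = .const _ (coordinatePoint a) := rfl
  simp only [hσ, hκ, hσ', hκ', CharTwo.add_self_eq_zero] at key
  have h1 := congrArg (Int.cast : ℤ → ZMod 2) (eulerCocycle_sphereSimplex hab)
  rw [Int.cast_sub, CharTwo.sub_eq_add, ← key] at h1
  simp at h1

end MilnorManifold

theorem proposition5p2 (s : ℕ) (hs : 2 ≤ s) :
    Function.Involutive (milnorSwap s) ∧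
    (∀ p : ComplexMilnorManifold s s le_rfl, milnorSwap s p ≠ p) ∧
    mod2CohomologyMap (milnorSwap s) ≠ 𝟙 _ :=
  ⟨fun _ => rfl, milnorSwap_ne_self, mod2CohomologyMap_milnorSwap_ne_id hs⟩
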